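/- Let $H$ be a complex Hilbert space, $\mathcal B(H)$ the Banach space of bounded linear operators on $H$ with the operator norm, $|T|=(T^*T)^{1/2}$ for $T\in\mathcal B(H)$, and $\mathbb D=\{z\in\mathbb C:|z|<1\}$. Call a holomorphic map $f:\mathbb D\to\mathcal B(H)$ biholomorphic (onto its image) if it has an inverse $h$, $h(f(z))=z$ for all $z\in\mathbb D$, that is holomorphic on an open subset of $\mathcal B(H)$ containing $f(\mathbb D)$; the image $f(\mathbb D)$ is not required to be open in $\mathcal B(H)$. (If $f(\mathbb D)$ is open, this is the usual notion of a biholomorphic map onto the domain $f(\mathbb D)$.) Call $f$ convex biholomorphic if moreover $(1-t)f(z_0)+tf(z)\in f(\mathbb D)$ for all $z_0,z\in\mathbb D$ and $t\in[0,1]$. A map $g:\mathbb D\to\mathcal B(H)$ is subordinate to $f$ if $g=f\circ\varphi$ for some holomorphic $\varphi:\mathbb D\to\mathbb D$ with $\varphi(0)=0$. Let $f:\mathbb D\to\mathcal B(H)$ be convex biholomorphic and let $g$ be subordinate to $f$, with expansions $f(z)=\sum_{n\ge0}A_nz^n$ and $g(z)=\sum_{k\ge0}B_kz^k$ in $\mathbb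 D$, where $A_n,B_k\in\mathcal B(H)$. Then: (a) If $A_1$ is invertible in $\mathcal B(H)$ (which is automatic when $f(\mathbb D)$ is open in $\mathcal B(H)$), then for all $0\le r\le 1/(1+2\|A_1\|\,\|A_1^{-1}\|)$ the series below converges and $$\sum_{k=1}^\infty\|B_k\|r^k\le\liminf_{|z|\to1^-}\|f(z)-f(0)\|.$$ (b) For all $0\le r\le 1/3$ the series $\sum_{k\ge1}|B_k|r^k$ converges in operator norm and $$\sum_{k=1}^\infty|B_k|r^k\le\tfrac12|A_1|$$ in the usual order of self-adjoint operators ($S\le T$ iff $T-S$ is positive semidefinite). -/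

import Mathlib

open Filter Topology Metric

/-- `f` is biholomorphic from `D` onto its image: `f` is holomorphic on `D`, and it has an inverse
`h` on `f(D)` which is holomorphic, i.e. is the restriction of a holomorphic map defined on an open
set `V ⊇ f(D)`. When `f(D)` is open in `Y` one may take `V = f(D)`, and this is the usual notion of
a biholomorphic map from the domain `D` onto the domain `f(D)`. Openness of `f(D)` in `Y` is not
imposed: maps from the disc into a space of dimension greater than one are to be covered. -/
structure IsBiholomorphicOntoImage {X Y : Type*} [NormedAddCommGroup X] [NormedSpace ℂ X]
    [NormedAddCommGroup Y] [NormedSpace ℂ Y] (f : X → Y) (D : Set X) : Prop where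
  holomorphic : DifferentiableOn ℂ f D
  holomorphic_inverse : ∃ (V : Set Y) (h : Y → X), IsOpen V ∧ f '' D ⊆ V ∧
    DifferentiableOn ℂ h V ∧ ∀ z ∈ D, h (f z) = z

/-- `f(D)` is starlike with respect to `f(z₀)`. -/
def IsStarlikeWrt {X Y : Type*} [AddCommGroup Y] [Module ℂ Y] (f : X → Y) (D : Set X)
    (z₀ : X) : Prop :=
  ∀ z ∈ D, ∀ t ∈ Set.Icc (0 : ℝ) 1, ((1 - t : ℝ) : ℂ) • f z₀ + (t : ℂ) • f z ∈ f '' D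

/-- Convex biholomorphic maps: biholomorphic, and starlike with respect to every point of `D`. -/
structure IsConvexBiholomorphic {X Y : Type*} [NormedAddCommGroup X] [NormedSpace ℂ X]
    [NormedAddCommGroup Y] [NormedSpace ℂ Y] (f : X → Y) (D : Set X) : Prop where
  biholomorphic : IsBiholomorphicOntoImage f D
  starlike : ∀ z₀ ∈ D, IsStarlikeWrt f D z₀

/-- `g` is subordinate to `f` in the unit disc: `g = f ∘ φ` there, for a holomorphic self-map `φ`
of the unit disc with `φ(0) = 0`. -/
def IsSubordinate {Y : Type*} (g f : ℂ → Y) : Prop :=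
  ∃ φ : ℂ → ℂ, DifferentiableOn ℂ φ (ball 0 1) ∧ φ 0 = 0 ∧
    (∀ z ∈ ball (0 : ℂ) 1, ‖φ z‖ < 1) ∧ ∀ z ∈ ball (0 : ℂ) 1, g z = f (φ z)

/-- The filter `|z| → 1-` in the unit disc. -/
noncomputable def normToOneBelow : Filter ℂ := comap (fun z : ℂ => ‖z‖) (𝓝[<] (1 : ℝ))

/-!
A convex biholomorphic map `f` on the unit disc takes its values in a complex affine line. Writing
`h` for the holomorphic inverse, the segment from `f z₀` to `f z` is `t ↦ f (w t)` with
`w t = h ((1 - t) f z₀ + t f z)`; differentiating at `t = 0` gives `f z - f z₀ ∈ ℂ f' z₀`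
(`IsConvexBiholomorphic.exists_sub_eq_smul_deriv`). Hence `f = f 0 + F • A₁` with a scalar convex
univalent function `F`, `F 0 = 0`, `F' 0 = 1` (`IsConvexBiholomorphic.exists_scalar`), and
`B_k = b_k • A₁` for `k ≥ 1`, where the `b_k` are the coefficients of `F ∘ φ`. Everything then
follows from two classical facts about `F`.

* `IsConvexBiholomorphic.norm_coeff_le_one` (Rogosinski): `|b_k| ≤ 1`. The mean of
  `G (ω ^ j z)` over the `k`-th roots of unity `ω ^ j` stays in the convex set `F(𝔻)` and equals
  `b_k z ^ k + ⋯`; pulling it back by `F⁻¹` gives a self-map of the disc vanishing to order `k`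
  at `0`, to which the Schwarz lemma of order `k` applies.
* `IsConvexBiholomorphic.ball_half_subset_image`: `F(𝔻)` contains the disc of radius `1 / 2`. A
  point outside `F(𝔻)` is separated from it by a half-plane, and the Borel–Carathéodory inequality
  bounds `|F' 0|` by twice the distance from `0` to the boundary of that half-plane. By compactness,
  `liminf |F z| ≥ 1 / 2` as `|z| → 1`.

Since `∑ |b_k| r ^ k ≤ r / (1 - r) ≤ 1 / 2` for `r ≤ 1 / 3`, and `|B_k| = |b_k| |A₁|`, the operator
inequality follows. The radius in the norm inequality is also at most `1 / 3`, because
`‖A₁‖ ‖A₁⁻¹‖ ≥ 1`, so that its left-hand side is at most `‖A₁‖ / 2 ≤ liminf ‖f z - f 0‖`.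
-/

/-! ### Power series on the unit disc -/

theorem hasFPowerSeriesAt_of_hasSum_ball {E : Type*} [NormedAddCommGroup E] [NormedSpace ℂ E]
    {f : ℂ → E} {a : ℕ → E}
    (h : ∀ z ∈ ball (0 : ℂ) 1, HasSum (fun n : ℕ => z ^ n • a n) (f z)) :
    HasFPowerSeriesAt f (fun n => ContinuousMultilinearMap.mkPiRing ℂ (Fin n) (a n)) 0 := by
  refine hasFPowerSeriesAt_iff'.2 ?_
  filter_upwards [ball_mem_nhds (0 : ℂ) one_pos] with z hz
  simpa [FormalMultilinearSeries.coeff] using h z hz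

theorem hasDerivAt_of_hasSum_ball {E : Type*} [NormedAddCommGroup E] [NormedSpace ℂ E]
    {f : ℂ → E} {a : ℕ → E}
    (h : ∀ z ∈ ball (0 : ℂ) 1, HasSum (fun n : ℕ => z ^ n • a n) (f z)) :
    HasDerivAt f (a 1) 0 := by
  simpa using (hasFPowerSeriesAt_of_hasSum_ball h).hasDerivAt

theorem eq_of_hasSum_ball {E : Type*} [NormedAddCommGroup E] [NormedSpace ℂ E]
    {f : ℂ → E} {a b : ℕ → E}
    (ha : ∀ z ∈ ball (0 : ℂ) 1, HasSum (fun n : ℕ => z ^ n • a n) (f z))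
    (hb : ∀ z ∈ ball (0 : ℂ) 1, HasSum (fun n : ℕ => z ^ n • b n) (f z)) : a = b := by
  have h := (hasFPowerSeriesAt_of_hasSum_ball ha).eq_formalMultilinearSeries
    (hasFPowerSeriesAt_of_hasSum_ball hb)
  funext n
  simpa [FormalMultilinearSeries.coeff] using
    congrArg (fun p : FormalMultilinearSeries ℂ ℂ E => p.coeff n) h

/-- If the coefficients of index less than `k` vanish, then `f z / z ^ k` tends to the `k`-th
coefficient as `z → 0`. -/
theorem tendsto_inv_pow_smul_of_hasSum_ball {E : Type*} [NormedAddCommGroup E] [NormedSpace ℂ E]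
    {f : ℂ → E} {a : ℕ → E} {k : ℕ}
    (h : ∀ z ∈ ball (0 : ℂ) 1, HasSum (fun n : ℕ => z ^ n • a n) (f z))
    (ha : ∀ j < k, a j = 0) :
    Tendsto (fun z : ℂ => (z ^ k)⁻¹ • f z) (𝓝[≠] 0) (𝓝 (a k)) := by
  choose! u hu hsum using fun z hz => HasSum.exists_hasSum_smul_of_apply_eq_zero (h z hz) ha
  have hp := hasFPowerSeriesAt_of_hasSum_ball hsum
  have h0 : u 0 = a k := by
    simpa using (hsum 0 (mem_ball_self one_pos)).unique (HasSum.hasSum_at_zero _)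
  have hc : Tendsto u (𝓝[≠] 0) (𝓝 (a k)) := h0 ▸ hp.continuousAt.tendsto.mono_left inf_le_left
  refine hc.congr' ?_
  filter_upwards [self_mem_nhdsWithin, mem_nhdsWithin_of_mem_nhds (ball_mem_nhds (0 : ℂ) one_pos)]
    with z hz hz1
  rw [← hu z hz1, inv_smul_smul₀ (pow_ne_zero k hz)]

theorem hasSum_pow_smul_single {E : Type*} [NormedAddCommGroup E] [NormedSpace ℂ E]
    (z : ℂ) (c : E) : HasSum (fun n : ℕ => z ^ n • (Pi.single 0 c : ℕ → E) n) c := by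
  have h := hasSum_single (f := fun n : ℕ => z ^ n • (Pi.single 0 c : ℕ → E) n) 0
    fun n hn => by simp [hn]
  simpa using h

theorem eq_zero_of_hasSum_const {E : Type*} [NormedAddCommGroup E] [NormedSpace ℂ E]
    {a : ℕ → E} {c : E}
    (h : ∀ z ∈ ball (0 : ℂ) 1, HasSum (fun n : ℕ => z ^ n • a n) c) {k : ℕ} (hk : k ≠ 0) :
    a k = 0 := by
  have h2 : a = Pi.single 0 c := by
    exact eq_of_hasSum_ball (f := fun _ => c) h fun z _ => hasSum_pow_smul_single z c
  simp [h2, hk]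

/-! ### Reduction to a scalar function -/

theorem IsConvexBiholomorphic.convex_image {Y : Type*} [NormedAddCommGroup Y] [NormedSpace ℂ Y]
    {f : ℂ → Y} {D : Set ℂ} (hf : IsConvexBiholomorphic f D) : Convex ℝ (f '' D) := by
  rintro _ ⟨z, hz, rfl⟩ _ ⟨w, hw, rfl⟩ s t hs ht hst
  have := hf.starlike z hz w hw t ⟨ht, by linarith⟩
  rw [Complex.coe_smul, Complex.coe_smul] at this
  rwa [show s = 1 - t by linarith]

/-- A convex biholomorphic map takes its values in the complex line through `f z₀` with direction
`f' z₀`: the segment from `f z₀` to `f z` lies in the image, hence is the image under `f` of a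
differentiable curve issuing from `z₀`, and the chain rule gives its direction. -/
theorem IsConvexBiholomorphic.exists_sub_eq_smul_deriv {Y : Type*} [NormedAddCommGroup Y]
    [NormedSpace ℂ Y] {f : ℂ → Y} {D : Set ℂ} (hf : IsConvexBiholomorphic f D) {f' : Y} {z₀ : ℂ}
    (hz₀ : z₀ ∈ D) (hf' : HasDerivAt f f' z₀) {z : ℂ} (hz : z ∈ D) :
    ∃ c : ℂ, f z - f z₀ = c • f' := by
  obtain ⟨V, h, hV, hDV, hh, hinv⟩ := hf.biholomorphic.holomorphic_inverse
  let c : ℝ → Y := fun t => f z₀ + t • (f z - f z₀)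
  have hc0 : c 0 = f z₀ := by simp [c]
  have hc : HasDerivAt c (f z - f z₀) 0 := by
    simpa [c] using ((hasDerivAt_id (0 : ℝ)).smul_const (f z - f z₀)).const_add (f z₀)
  have hcD : ∀ t ∈ Set.Icc (0 : ℝ) 1, c t ∈ f '' D := by
    intro t ht
    convert! hf.starlike z₀ hz₀ z hz t ht using 1
    rw [Complex.coe_smul, Complex.coe_smul]
    simp only [c, sub_smul, smul_sub, one_smul]
    abel
  have hhd : HasFDerivAt h (fderiv ℂ h (c 0)) (c 0) := by
    rw [hc0]
    exact ((hh _ (hDV ⟨z₀, hz₀, rfl⟩)).differentiableAt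
      (hV.mem_nhds (hDV ⟨z₀, hz₀, rfl⟩))).hasFDerivAt
  have hw := (hhd.restrictScalars ℝ).comp_hasDerivAt (0 : ℝ) hc
  have hw0 : (h ∘ c) 0 = z₀ := by simp [hc0, hinv z₀ hz₀]
  have hfw := HasDerivAt.scomp (𝕜' := ℂ) (0 : ℝ) (hw0.symm ▸ hf') hw
  have hEq : ∀ t ∈ Set.Icc (0 : ℝ) 1, (f ∘ (h ∘ c)) t = c t := by
    intro t ht
    obtain ⟨w, hw, hwt⟩ := hcD t ht
    simp [← hwt, hinv w hw]
  -- `c` lies in the image only for `t ∈ [0, 1]`, so one-sided derivatives at `0` are compared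
  refine ⟨_, (uniqueDiffOn_Icc (zero_lt_one' ℝ) 0 (by simp)).eq_deriv _ hc.hasDerivWithinAt
    (hfw.hasDerivWithinAt.congr_of_mem (fun t ht => (hEq t ht).symm) (by simp))⟩

/-- A convex biholomorphic map of the disc is an affine copy of a normalized scalar one. -/
theorem IsConvexBiholomorphic.exists_scalar {Y : Type*} [NormedAddCommGroup Y]
    [NormedSpace ℂ Y] {f : ℂ → Y} {f' : Y} (hf : IsConvexBiholomorphic f (ball 0 1))
    (hf' : HasDerivAt f f' 0) :
    f' ≠ 0 ∧ ∃ F : ℂ → ℂ, IsConvexBiholomorphic F (ball 0 1) ∧ F 0 = 0 ∧ HasDerivAt F 1 0 ∧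
      ∀ z ∈ ball (0 : ℂ) 1, f z = f 0 + F z • f' := by
  have h0 : (0 : ℂ) ∈ ball (0 : ℂ) 1 := mem_ball_self one_pos
  obtain ⟨V, h, hV, hDV, hh, hinv⟩ := hf.biholomorphic.holomorphic_inverse
  have hne : f' ≠ 0 := by
    rintro rfl
    have hm : (1 / 2 : ℂ) ∈ ball (0 : ℂ) 1 := by simp; norm_num
    obtain ⟨c, hc⟩ := hf.exists_sub_eq_smul_deriv h0 hf' hm
    have h1 : f (1 / 2) = f 0 := by simpa [sub_eq_zero] using hc
    have h2 := hinv _ hm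
    rw [h1, hinv 0 h0] at h2
    norm_num at h2
  obtain ⟨l, hl⟩ := SeparatingDual.exists_eq_one (R := ℂ) hne
  have key : ∀ z ∈ ball (0 : ℂ) 1, f z = f 0 + l (f z - f 0) • f' := by
    intro z hz
    obtain ⟨c, hc⟩ := hf.exists_sub_eq_smul_deriv h0 hf' hz
    rw [hc, map_smul, hl, smul_eq_mul, mul_one, ← hc, add_sub_cancel]
  -- `F` is the coordinate of `f - f 0` on the line `ℂ f'`, read off by a functional with `l f' = 1`
  refine ⟨hne, fun z => l (f z - f 0), ⟨⟨?_, ?_⟩, ?_⟩, by simp, ?_, key⟩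
  · exact l.differentiable.comp_differentiableOn (hf.biholomorphic.holomorphic.sub_const _)
  · refine ⟨(fun w : ℂ => f 0 + w • f') ⁻¹' V, fun w => h (f 0 + w • f'),
      hV.preimage (by fun_prop), ?_, ?_, ?_⟩
    · rintro _ ⟨z, hz, rfl⟩
      change f 0 + l (f z - f 0) • f' ∈ V
      rw [← key z hz]
      exact hDV ⟨z, hz, rfl⟩
    · exact hh.comp (f := fun w : ℂ => f 0 + w • f')
        (Differentiable.differentiableOn (by fun_prop)) (fun w hw => hw)
    · intro z hz
      change h (f 0 + l (f z - f 0) • f') = z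
      rw [← key z hz, hinv z hz]
  · intro z hz w hw t ht
    obtain ⟨v, hv, hvt⟩ := hf.starlike z hz w hw t ht
    refine ⟨v, hv, ?_⟩
    simp only [hvt, map_add, map_sub, map_smul, smul_eq_mul]
    push_cast
    ring
  · have := l.hasFDerivAt.comp_hasDerivAt (0 : ℂ) (hf'.sub_const (f 0))
    rwa [hl] at this

/-! ### Coefficients of functions subordinate to a convex function -/

theorem sum_pow_primitiveRoot {ω : ℂ} {k n : ℕ} (hω : IsPrimitiveRoot ω k) (hn : ¬ k ∣ n) :
    ∑ j ∈ Finset.range k, (ω ^ j) ^ n = 0 := by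
  have h1 : ω ^ n ≠ 1 := fun h => hn (hω.dvd_of_pow_eq_one n h)
  have h2 : ∑ j ∈ Finset.range k, (ω ^ n) ^ j = 0 := by
    rw [geom_sum_eq h1, ← pow_mul, mul_comm, pow_mul, hω.pow_eq_one]
    simp
  rw [← h2]
  exact Finset.sum_congr rfl fun j _ => by rw [← pow_mul, ← pow_mul, mul_comm]

/-- Rogosinski's coefficient bound, for a holomorphic `G` with `G 0 = 0` whose values lie in the
image of a normalized convex function. -/
theorem IsConvexBiholomorphic.norm_coeff_le_one {F : ℂ → ℂ}
    (hF : IsConvexBiholomorphic F (ball 0 1)) (hF0 : F 0 = 0) (hF' : HasDerivAt F 1 0)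
    {G : ℂ → ℂ} (hG : DifferentiableOn ℂ G (ball 0 1)) (hG0 : G 0 = 0)
    (hGF : ∀ z ∈ ball (0 : ℂ) 1, G z ∈ F '' ball 0 1) {b : ℕ → ℂ}
    (hb : ∀ z ∈ ball (0 : ℂ) 1, HasSum (fun n : ℕ => z ^ n • b n) (G z))
    {k : ℕ} (hk : k ≠ 0) : ‖b k‖ ≤ 1 := by
  have h0 : (0 : ℂ) ∈ ball (0 : ℂ) 1 := mem_ball_self one_pos
  have hkC : (k : ℂ) ≠ 0 := Nat.cast_ne_zero.2 hk
  have hkR : (k : ℝ) ≠ 0 := Nat.cast_ne_zero.2 hk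
  obtain ⟨V, h, hV, hDV, hh, hinv⟩ := hF.biholomorphic.holomorphic_inverse
  obtain ⟨ω, hω⟩ : ∃ ω : ℂ, IsPrimitiveRoot ω k := ⟨_, Complex.isPrimitiveRoot_exp k hk⟩
  have hωn : ∀ j : ℕ, ‖ω ^ j‖ = 1 := fun j => by simp [hω.norm'_eq_one hk]
  have hmem : ∀ (j : ℕ) {z : ℂ}, z ∈ ball (0 : ℂ) 1 → ω ^ j * z ∈ ball (0 : ℂ) 1 := by
    intro j z hz
    simpa [hω.norm'_eq_one hk] using hz
  -- averaging over the `k`-th roots of unity keeps the values in the convex image, and keeps of the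
  -- power series of `G` exactly the terms whose index is divisible by `k`
  let g : ℂ → ℂ := fun z => ∑ j ∈ Finset.range k, (k : ℂ)⁻¹ * G (ω ^ j * z)
  have hg0 : g 0 = 0 := by simp [g, hG0]
  have hgd : DifferentiableOn ℂ g (ball 0 1) := by
    refine DifferentiableOn.fun_sum fun j _ => ?_
    exact (hG.comp (f := fun z => ω ^ j * z) (by fun_prop) (fun z hz => hmem j hz)).const_mul _
  have hgF : ∀ z ∈ ball (0 : ℂ) 1, g z ∈ F '' ball 0 1 := by
    intro z hz
    have := hF.convex_image.sum_mem (t := Finset.range k) (w := fun _ => (k : ℝ)⁻¹)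
      (z := fun j => G (ω ^ j * z)) (fun _ _ => by positivity) (by simp [hkR])
      (fun j _ => hGF _ (hmem j hz))
    simpa [g, Complex.real_smul] using this
  let a : ℕ → ℂ := fun n => (∑ j ∈ Finset.range k, (k : ℂ)⁻¹ * (ω ^ j) ^ n) * b n
  have hga : ∀ z ∈ ball (0 : ℂ) 1, HasSum (fun n : ℕ => z ^ n • a n) (g z) := by
    intro z hz
    have := hasSum_sum (s := Finset.range k)
      fun j _ => (hb _ (hmem j hz)).mul_left ((k : ℂ)⁻¹)
    refine this.congr_fun ?_
    intro n
    simp only [a, smul_eq_mul, Finset.sum_mul, Finset.mul_sum]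
    exact Finset.sum_congr rfl fun j _ => by rw [mul_pow]; ring
  have hb0 : b 0 = 0 := by
    rw [← hG0]
    exact (HasSum.hasSum_at_zero b).unique (hb 0 h0)
  have ha : ∀ n < k, a n = 0 := by
    intro n hn
    rcases Nat.eq_zero_or_pos n with rfl | hpos
    · simp [a, hb0]
    · simp only [a, ← Finset.mul_sum]
      rw [sum_pow_primitiveRoot hω (Nat.not_dvd_of_pos_of_lt hpos hn)]
      simp
  have hak : a k = b k := by
    have : ∀ j, (ω ^ j) ^ k = 1 := fun j => by rw [← pow_mul, mul_comm, pow_mul, hω.pow_eq_one,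
      one_pow]
    simp [a, this, hkC]
  have hlim := tendsto_inv_pow_smul_of_hasSum_ball hga ha
  rw [hak] at hlim
  -- the pullback of `g` by `F`: a self-map of the disc, of order `z ^ k` at `0`
  let ψ : ℂ → ℂ := fun z => h (g z)
  have hψF : ∀ z ∈ ball (0 : ℂ) 1, ψ z ∈ ball (0 : ℂ) 1 ∧ F (ψ z) = g z := by
    intro z hz
    obtain ⟨w, hw, hwz⟩ := hgF z hz
    have hψw : ψ z = w := by simp only [ψ, ← hwz, hinv w hw]
    exact ⟨hψw ▸ hw, by rw [hψw, hwz]⟩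
  have hψ0 : ψ 0 = 0 := by
    simp only [ψ, hg0]
    rw [← hF0, hinv 0 h0, hF0]
  have hψd : DifferentiableOn ℂ ψ (ball 0 1) :=
    hh.comp hgd fun z hz => hDV (hgF z hz)
  have hψc : Tendsto ψ (𝓝 0) (𝓝 0) := by
    have := (hψd.differentiableAt (ball_mem_nhds 0 one_pos)).continuousAt.tendsto
    rwa [hψ0] at this
  have hgc : Tendsto g (𝓝 0) (𝓝 0) := by
    have := (hgd.differentiableAt (ball_mem_nhds 0 one_pos)).continuousAt.tendsto
    rwa [hg0] at this
  have hgO : g =O[𝓝 0] fun z => z ^ k := by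
    refine Asymptotics.IsBigO.of_bound (‖b k‖ + 1) ?_
    filter_upwards [eventually_nhdsWithin_iff.1
      (hlim.norm.eventually (gt_mem_nhds (lt_add_one ‖b k‖)))] with z hz
    rcases eq_or_ne z 0 with rfl | hz0
    · simp [hg0, hk]
    · have h1 := (hz hz0).le
      rwa [norm_smul, norm_inv, inv_mul_le_iff₀ (norm_pos_iff.2 (pow_ne_zero k hz0)),
        mul_comm] at h1
  have hψO : ψ =O[𝓝 0] fun z => z ^ k := by
    have hV0 : (0 : ℂ) ∈ V := hF0 ▸ hDV ⟨0, h0, rfl⟩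
    have hd := ((hh 0 hV0).differentiableAt (hV.mem_nhds hV0)).isBigO_sub
    have h00 : h 0 = 0 := by simpa [ψ, hg0] using hψ0
    simp only [h00, sub_zero] at hd
    exact (hd.comp_tendsto hgc).trans hgO
  have hbound : ∀ z ∈ ball (0 : ℂ) 1, ‖ψ z‖ ≤ ‖z‖ ^ k := by
    intro z hz
    obtain ⟨m, rfl⟩ := Nat.exists_eq_succ_of_ne_zero hk
    have := Complex.dist_le_mul_div_pow_of_mapsTo_ball_of_isLittleO (n := m) (R₂ := 1) hψd
      (fun w hw => by rw [hψ0]; exact ball_subset_closedBall (hψF w hw).1) ?_ hz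
    · simpa [hψ0] using this
    · simp only [hψ0, sub_zero]
      simpa only [norm_pow] using
        (hψO.trans_isLittleO (Asymptotics.isLittleO_pow_pow (Nat.lt_succ_self m))).norm_right
  -- `|g z| = |F (ψ z)| ≤ (1 + ε) |ψ z| ≤ (1 + ε) |z| ^ k` near `0`, while `g z / z ^ k → b k`
  refine le_of_forall_pos_le_add fun ε hε => le_of_tendsto hlim.norm ?_
  have hFε : ∀ᶠ w in 𝓝 (0 : ℂ), ‖F w‖ ≤ (1 + ε) * ‖w‖ := by
    have := (hasDerivAt_iff_isLittleO.1 hF').def hε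
    filter_upwards [this] with w hw
    simp only [hF0, sub_zero, smul_eq_mul, mul_one] at hw
    calc ‖F w‖ = ‖(F w - w) + w‖ := by ring_nf
      _ ≤ ‖F w - w‖ + ‖w‖ := norm_add_le _ _
      _ ≤ _ := by linarith
  filter_upwards [self_mem_nhdsWithin, mem_nhdsWithin_of_mem_nhds (ball_mem_nhds (0 : ℂ) one_pos),
    mem_nhdsWithin_of_mem_nhds (hψc.eventually hFε)] with z hz hz1 hz2
  have hzk : 0 < ‖z‖ ^ k := pow_pos (norm_pos_iff.2 hz) k
  rw [norm_smul, norm_inv, norm_pow, inv_mul_le_iff₀ hzk, ← (hψF z hz1).2, mul_comm]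
  exact hz2.trans (mul_le_mul_of_nonneg_left (hbound z hz1) (by positivity))

/-! ### The disc of radius one half in the image -/

theorem IsBiholomorphicOntoImage.isOpen_image_ball {F : ℂ → ℂ}
    (hF : IsBiholomorphicOntoImage F (ball 0 1)) : IsOpen (F '' ball 0 1) := by
  obtain ⟨V, h, hV, hDV, hh, hinv⟩ := hF.holomorphic_inverse
  rcases (hF.holomorphic.analyticOnNhd isOpen_ball).is_constant_or_isOpen
    (convex_ball 0 1).isPreconnected with ⟨w, hw⟩ | ho
  · have h0 : (0 : ℂ) ∈ ball (0 : ℂ) 1 := mem_ball_self one_pos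
    have hm : (1 / 2 : ℂ) ∈ ball (0 : ℂ) 1 := by simp; norm_num
    have h2 := hinv _ hm
    rw [hw _ hm, ← hw 0 h0, hinv 0 h0] at h2
    norm_num at h2
  · exact ho _ subset_rfl isOpen_ball

/-- The image of a normalized convex function of the unit disc contains the disc of
radius `1 / 2`. -/
theorem IsConvexBiholomorphic.ball_half_subset_image {F : ℂ → ℂ}
    (hF : IsConvexBiholomorphic F (ball 0 1)) (hF0 : F 0 = 0) (hF' : HasDerivAt F 1 0) :
    ball (0 : ℂ) (1 / 2) ⊆ F '' ball 0 1 := by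
  intro w hw
  by_contra hwF
  obtain ⟨u, hu⟩ := RCLike.geometric_hahn_banach_open_point (𝕜 := ℂ) hF.convex_image
    hF.biholomorphic.isOpen_image_ball hwF
  have hM : 0 < (u w).re := by
    simpa [hF0] using hu (F 0) ⟨0, mem_ball_self one_pos, rfl⟩
  have huv : ∀ v : ℂ, u v = v * u 1 := fun v => by
    rw [← smul_eq_mul, ← map_smul, smul_eq_mul, mul_one]
  set M := (u w).re with hMdef
  have hderiv : HasDerivAt (fun z => u (F z)) (u 1) 0 := u.hasFDerivAt.comp_hasDerivAt 0 hF'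
  -- Borel–Carathéodory for `u ∘ F`, whose real part is less than `M`, divided by `‖z‖` as `z → 0`
  have hle : ‖u 1‖ ≤ 2 * M := by
    have hlim : Tendsto (fun z : ℂ => 2 * M / (1 - ‖z‖)) (𝓝[≠] 0) (𝓝 (2 * M)) := by
      have : ContinuousAt (fun z : ℂ => 2 * M / (1 - ‖z‖)) 0 :=
        ContinuousAt.div (by fun_prop) (by fun_prop) (by simp)
      simpa using this.tendsto.mono_left nhdsWithin_le_nhds
    refine le_of_tendsto_of_tendsto hderiv.tendsto_slope.norm hlim ?_
    filter_upwards [self_mem_nhdsWithin,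
      mem_nhdsWithin_of_mem_nhds (ball_mem_nhds (0 : ℂ) one_pos)] with z hz hz1
    have hzpos : 0 < ‖z‖ := norm_pos_iff.2 hz
    have hBC := Complex.borelCaratheodory_zero (f := fun z => u (F z)) hM
      (u.differentiable.comp_differentiableOn hF.biholomorphic.holomorphic)
      (fun v hv => (hu _ ⟨v, hv, rfl⟩).le) one_pos hz1 (by simp [hF0])
    simp only [slope_def_module, hF0, map_zero, sub_zero, norm_smul, norm_inv]
    rw [inv_mul_le_iff₀ hzpos]
    exact hBC.trans_eq (by ring)
  have h2 : M ≤ ‖w‖ * ‖u 1‖ := by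
    rw [← norm_mul, ← huv]
    exact Complex.re_le_norm _
  have hw2 : ‖w‖ < 1 / 2 := by simpa using hw
  have hu1 : 0 < ‖u 1‖ := by
    rcases (norm_nonneg (u 1)).eq_or_lt with h | h
    · rw [← h] at h2; linarith
    · exact h
  nlinarith

/-- The preimage of a closed disc of radius `ρ < 1 / 2` is compact in the unit disc, so `F z` leaves
that closed disc when `z` approaches the unit circle. -/
theorem IsConvexBiholomorphic.eventually_le_norm {F : ℂ → ℂ}
    (hF : IsConvexBiholomorphic F (ball 0 1)) (hF0 : F 0 = 0) (hF' : HasDerivAt F 1 0)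
    {ρ : ℝ} (hρ : ρ < 1 / 2) : ∀ᶠ z in normToOneBelow, z ∈ ball (0 : ℂ) 1 ∧ ρ ≤ ‖F z‖ := by
  obtain ⟨V, h, hV, hDV, hh, hinv⟩ := hF.biholomorphic.holomorphic_inverse
  have hsub : closedBall (0 : ℂ) ρ ⊆ F '' ball 0 1 :=
    (closedBall_subset_ball hρ).trans (hF.ball_half_subset_image hF0 hF')
  have hcomp : IsCompact (h '' closedBall 0 ρ) :=
    (isCompact_closedBall _ _).image_of_continuousOn (hh.continuousOn.mono (hsub.trans hDV))
  have hball : h '' closedBall 0 ρ ⊆ ball 0 1 := by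
    rintro _ ⟨w, hw, rfl⟩
    obtain ⟨z, hz, rfl⟩ := hsub hw
    rwa [hinv z hz]
  obtain ⟨m, hm, hmb⟩ := exists_lt_subset_ball hcomp.isClosed hball
  refine Filter.mem_comap.2 ⟨Set.Ioo m 1, Ioo_mem_nhdsLT hm, ?_⟩
  intro z hz
  have hz1 : z ∈ ball (0 : ℂ) 1 := by simpa using hz.2
  refine ⟨hz1, not_lt.1 fun hlt => ?_⟩
  have := hmb ⟨F z, by simpa using hlt.le, rfl⟩
  rw [hinv z hz1, mem_ball_zero_iff] at this
  exact lt_asymm this hz.1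

/-! ### The operator inequalities -/

theorem summable_and_tsum_le_of_norm_le_one {b : ℕ → ℂ} (hb : ∀ k, ‖b (k + 1)‖ ≤ 1) {r : ℝ}
    (hr0 : 0 ≤ r) (hr1 : r < 1) :
    Summable (fun k : ℕ => r ^ (k + 1) * ‖b (k + 1)‖) ∧
      ∑' k : ℕ, r ^ (k + 1) * ‖b (k + 1)‖ ≤ r / (1 - r) := by
  have hg : HasSum (fun k : ℕ => r ^ (k + 1)) (r / (1 - r)) := by
    simpa only [pow_succ', div_eq_mul_inv] using (hasSum_geometric_of_lt_one hr0 hr1).mul_left r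
  have hle : ∀ k : ℕ, r ^ (k + 1) * ‖b (k + 1)‖ ≤ r ^ (k + 1) := fun k =>
    mul_le_of_le_one_right (by positivity) (hb k)
  have hs := Summable.of_nonneg_of_le (fun k => by positivity) hle hg.summable
  exact ⟨hs, hg.tsum_eq ▸ hs.tsum_le_tsum hle hg.summable⟩

theorem mainTheorem3 {H : Type*} [NormedAddCommGroup H] [InnerProductSpace ℂ H] [CompleteSpace H]
    (f g : ℂ → H →L[ℂ] H) (A B : ℕ → H →L[ℂ] H)
    (hf : IsConvexBiholomorphic f (ball 0 1))
    (hg : IsSubordinate g f)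
    (hA : ∀ z ∈ ball (0 : ℂ) 1, HasSum (fun n : ℕ => z ^ n • A n) (f z))
    (hB : ∀ z ∈ ball (0 : ℂ) 1, HasSum (fun k : ℕ => z ^ k • B k) (g z)) :
    -- when the image is a domain of `B(H)`, the operator `A₁` is invertible
    (IsOpen (f '' ball 0 1) → IsUnit (A 1)) ∧
    -- the norm inequality
    (IsUnit (A 1) → ∀ r : ℝ, 0 ≤ r → r ≤ 1 / (1 + 2 * ‖A 1‖ * ‖Ring.inverse (A 1)‖) →
      Summable (fun k : ℕ => ‖B (k + 1)‖ * r ^ (k + 1)) ∧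
      ENNReal.ofReal (∑' k : ℕ, ‖B (k + 1)‖ * r ^ (k + 1)) ≤
        liminf (fun z : ℂ => ENNReal.ofReal ‖f z - f 0‖) normToOneBelow) ∧
    -- the operator inequality, in the Loewner order, for `|T| = (T* T) ^ (1 / 2)`
    (∀ r : ℝ, 0 ≤ r → r ≤ 1 / 3 →
      Summable (fun k : ℕ => r ^ (k + 1) • CFC.abs (B (k + 1))) ∧
      ∑' k : ℕ, r ^ (k + 1) • CFC.abs (B (k + 1)) ≤ (1 / 2 : ℝ) • CFC.abs (A 1)) := by
  have h0 : (0 : ℂ) ∈ ball (0 : ℂ) 1 := mem_ball_self one_pos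
  obtain ⟨hA1, F, hF, hF0, hF', hfF⟩ := hf.exists_scalar (hasDerivAt_of_hasSum_ball hA)
  obtain ⟨φ, hφ, hφ0, hφ1, hgφ⟩ := hg
  have hφb : Set.MapsTo φ (ball 0 1) (ball 0 1) := fun z hz => by simpa using hφ1 z hz
  obtain ⟨l, hl⟩ := SeparatingDual.exists_eq_one (R := ℂ) hA1
  have hgF : ∀ z ∈ ball (0 : ℂ) 1, g z = f 0 + F (φ z) • A 1 := fun z hz => by
    rw [hgφ z hz, hfF _ (hφb hz)]
  -- `F ∘ φ` is expanded by applying `l` to `g = f 0 + (F ∘ φ) • A 1`; only the constant term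
  -- has to be corrected, by `l (f 0)`
  obtain ⟨b, hb⟩ : ∃ b : ℕ → ℂ, ∀ z ∈ ball (0 : ℂ) 1,
      HasSum (fun n : ℕ => z ^ n • b n) (F (φ z)) := by
    refine ⟨fun n => l (B n) - Pi.single (M := fun _ => ℂ) 0 (l (f 0)) n, fun z hz => ?_⟩
    have h1 := l.hasSum (hB z hz)
    have h2 := hasSum_pow_smul_single z (l (f 0))
    convert! h1.sub h2 using 1
    · funext n
      simp [mul_sub]
    · simp [hgF z hz, hl]
  have hbB : ∀ k : ℕ, B (k + 1) = b (k + 1) • A 1 := by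
    intro k
    have := eq_zero_of_hasSum_const (a := fun n => B n - b n • A 1) (c := f 0) (fun z hz => by
      convert! (hB z hz).sub ((hb z hz).smul_const (A 1)) using 1
      · funext n
        simp [smul_sub, mul_smul]
      · simp [hgF z hz]) (Nat.succ_ne_zero k)
    exact sub_eq_zero.1 this
  have hb1 : ∀ k : ℕ, ‖b (k + 1)‖ ≤ 1 := fun k =>
    hF.norm_coeff_le_one hF0 hF' (hF.biholomorphic.holomorphic.comp hφ hφb) (by simp [hφ0, hF0])
      (fun z hz => ⟨φ z, hφb hz, rfl⟩) hb (Nat.succ_ne_zero k)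
  refine ⟨fun ho => ?_, fun hu r hr0 hr => ?_, fun r hr0 hr => ?_⟩
  · -- near `f 0` the open image contains `f 0 + ε • 1` for small `ε ≠ 0`, so `1` is a multiple
    -- of `A 1`
    have hc : Tendsto (fun ε : ℂ => f 0 + ε • (1 : H →L[ℂ] H)) (𝓝[≠] 0) (𝓝 (f 0)) := by
      have : ContinuousAt (fun ε : ℂ => f 0 + ε • (1 : H →L[ℂ] H)) 0 := by fun_prop
      simpa using this.tendsto.mono_left nhdsWithin_le_nhds
    obtain ⟨ε, ⟨z, hz, hzε⟩, hε⟩ :=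
      ((hc.eventually (ho.mem_nhds ⟨0, h0, rfl⟩)).and self_mem_nhdsWithin).exists
    rw [hfF z hz, add_right_inj] at hzε
    have hε' : ε ≠ 0 := hε
    have h1 : (ε⁻¹ * F z) • A 1 = 1 := by rw [mul_smul, hzε, inv_smul_smul₀ hε']
    exact ⟨⟨A 1, (ε⁻¹ * F z) • 1, by simpa using h1, by simpa using h1⟩, rfl⟩
  · have hpos : 0 < ‖A 1‖ := norm_pos_iff.2 hA1
    have hone : 1 ≤ ‖A 1‖ * ‖Ring.inverse (A 1)‖ := by
      have : Nontrivial (H →L[ℂ] H) := ⟨⟨A 1, 0, hA1⟩⟩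
      calc (1 : ℝ) ≤ ‖(1 : H →L[ℂ] H)‖ := one_le_norm_one _
        _ = ‖A 1 * Ring.inverse (A 1)‖ := by rw [Ring.mul_inverse_cancel _ hu]
        _ ≤ _ := norm_mul_le _ _
    have hr3 : r ≤ 1 / 3 := hr.trans (one_div_le_one_div_of_le (by norm_num) (by nlinarith))
    obtain ⟨hs, hle⟩ := summable_and_tsum_le_of_norm_le_one hb1 hr0 (by linarith)
    have heq : ∀ k : ℕ, ‖B (k + 1)‖ * r ^ (k + 1) = ‖A 1‖ * (r ^ (k + 1) * ‖b (k + 1)‖) :=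
      fun k => by rw [hbB, norm_smul]; ring
    simp only [heq]
    refine ⟨hs.mul_left _, ?_⟩
    have hhalf : r / (1 - r) ≤ 1 / 2 := by
      rw [div_le_iff₀ (by linarith)]; linarith
    rw [tsum_mul_left]
    have hlim : Tendsto (fun ρ : ℝ => ENNReal.ofReal (‖A 1‖ * ρ)) (𝓝[<] (1 / 2))
        (𝓝 (ENNReal.ofReal (‖A 1‖ * (1 / 2)))) := by
      have : Continuous fun ρ : ℝ => ENNReal.ofReal (‖A 1‖ * ρ) :=
        ENNReal.continuous_ofReal.comp (continuous_const.mul continuous_id)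
      exact this.continuousWithinAt.tendsto
    refine (ENNReal.ofReal_le_ofReal (mul_le_mul_of_nonneg_left (hle.trans hhalf) hpos.le)).trans
      (le_of_tendsto hlim ?_)
    filter_upwards [self_mem_nhdsWithin] with ρ hρ
    refine le_liminf_of_le (by isBoundedDefault) ?_
    filter_upwards [hF.eventually_le_norm hF0 hF' hρ] with z hz
    refine ENNReal.ofReal_le_ofReal ?_
    rw [hfF z hz.1, add_sub_cancel_left, norm_smul, mul_comm]
    exact mul_le_mul_of_nonneg_right hz.2 hpos.le
  · obtain ⟨hs, hle⟩ := summable_and_tsum_le_of_norm_le_one hb1 hr0 (by linarith)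
    have heq : ∀ k : ℕ, r ^ (k + 1) • CFC.abs (B (k + 1)) =
        (r ^ (k + 1) * ‖b (k + 1)‖) • CFC.abs (A 1) := fun k => by
      rw [hbB, CFC.abs_smul, mul_smul]
    simp only [heq]
    refine ⟨hs.smul_const _, ?_⟩
    rw [hs.tsum_smul_const]
    refine smul_le_smul_of_nonneg_right (hle.trans ?_) (CFC.abs_nonneg _)
    rw [div_le_iff₀ (by linarith)]; linarith
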